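/- Theorem. Let $c:\mathbb{R}^n\times\mathbb{R}^m\times\mathbb{R}\to\mathbb{R}$, $g:\mathbb{R}^n\to\mathbb{R}$, $f:\mathbb{R}^n\times\mathbb{R}^m\to\mathbb{R}^n$, $T\ge 0$, and let $U\subset\mathbb{R}^m$ be compact. Suppose that $c$, $g$, $f$ are locally Lipschitz (Lipschitz on every compact subset) on $\mathbb{R}^n\times U\times[0,T]$, $\mathbb{R}^n$ and $\mathbb{R}^n\times U$ respectively; that is, $\{c,g,f,\mathbb{R}^n,U,T\}$ is a state-unconstrained family of Lipschitz optimal control problems. For $x_0\in\mathbb{R}^n$ and $S\ge 0$ let $\mathcal{U}_S(x_0)$ be the set of measurable $\mathbf{u}:[0,S]\to U$ for which $x(t)=x_0+\int_0^t f(x(s),\mathbf{u}(s))\,ds$ has a unique continuous solution on $[0,S]$, denoted $\phi_f(x_0,t,\mathbf{u})$. The forward reachable set of $x_0$ is $FR_f(x_0,\mathbb{R}^n,U,[0,T])=\{\phi_f(x_0,S,\mathbf{u}): S\in[0,T],\ \mathbf{u}\in\mathcal{U}_S(x_0)\}$. For $\mathbf{u}\in\mathcal{U}_T(x_0)$ the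 cost is $\mathcal{C}(x_0,\mathbf{u})=\int_0^T c(\phi_f(x_0,s,\mathbf{u}),\mathbf{u}(s),s)\,ds+g(\phi_f(x_0,T,\mathbf{u}))$, and the sub-optimality loss is $L(x_0,\mathbf{u})=\mathcal{C}(x_0,\mathbf{u})-\inf_{\mathbf{v}\in\mathcal{U}_T(x_0)}\mathcal{C}(x_0,\mathbf{v})\in[0,\infty]$. Let $V^*:\mathbb{R}^n\times\mathbb{R}\to\mathbb{R}$ be continuous on $\mathbb{R}^n\times[0,T]$ and a viscosity solution of the Hamilton-Jacobi-Bellman terminal value problem $$\nabla_t V+\inf_{u\in U}\{c(x,u,t)+\nabla_x V(x,t)^\top f(x,u)\}=0\ \text{ on }\mathbb{R}^n\times(0,T),\qquad V(x,T)=g(x),$$ where, as usual for terminal value problems, the viscosity inequalities are those of the equation $-\nabla_t V-\inf_{u\in U}\{c+\nabla_xV^\top f\}=0$ (the expression on the left is $\le 0$ on the superdifferential and $\ge 0$ on the subdifferential of $V$). Let $J\in C^2(\mathbb{R}^n\times\mathbb{R},\mathbb{R})$, let $x_0\in\mathbb{R}^n$, and let $\Omega\subset\mathbb{R}^n$ be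 an open set with $FR_f(x_0,\mathbb{R}^n,U,[0,T])\subseteq\Omega$. Let $k_J$ be any function with $$k_J(x,t)\in\arg\inf_{u\in U}\{c(x,u,t)+\nabla_xJ(x,t)^\top f(x,u)\}\quad\text{for all }(x,t)\in\mathbb{R}^n\times[0,T],$$ and let $\mathbf{u}_J\in\mathcal{U}_T(x_0)$ satisfy $\mathbf{u}_J(t)=k_J(\phi_f(x_0,t,\mathbf{u}_J),t)$ for all $t\in[0,T]$. Then $$L(x_0,\mathbf{u}_J)\le C\,\|J-V^*\|_{W^{1,\infty}(\Omega\times[0,T],\mathbb{R})},\qquad C=2\max\Big\{1,\ T,\ T\max_{1\le i\le n}\ \sup_{(x,u)\in\Omega\times U}|f_i(x,u)|\Big\}.$$ Here $\|F\|_{W^{1,\infty}}$ is the sum of the essential suprema, over $\Omega\times(0,T)$, of $|F|$ and of the absolute values of its $n+1$ weak first-order partial derivatives, and is $\infty$ if one of these weak derivatives does not exist. All quantities may be $+\infty$, with $0\cdot\infty=0$. -/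

import Mathlib

open MeasureTheory Set
open scoped ENNReal NNReal ContDiff

namespace OptimalControl

/-- The state space `ℝⁿ` and the input space `ℝᵐ`, with the Euclidean norm. -/
abbrev Vec (n : ℕ) : Type := EuclideanSpace ℝ (Fin n)

/-- Local Lipschitz continuity on a set: Lipschitz on each of its compact subsets. -/
def LocLipOn {X Y : Type*} [PseudoEMetricSpace X] [PseudoEMetricSpace Y]
    (F : X → Y) (S : Set X) : Prop :=
  ∀ K : Set X, K ⊆ S → IsCompact K → ∃ L : ℝ≥0, LipschitzOnWith L F K

/-- `{c, g, f, X, U, T}` is a family of Lipschitz optimal control problems with running cost `c`,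
terminal cost `g`, vector field `f`, state constraint `X`, input constraint `U`, final time `T`. -/
structure IsLipschitzOCP {n m : ℕ} (c : Vec n → Vec m → ℝ → ℝ) (g : Vec n → ℝ)
    (f : Vec n → Vec m → Vec n) (X : Set (Vec n)) (U : Set (Vec m)) (T : ℝ) : Prop where
  running_cost : LocLipOn (fun p : Vec n × Vec m × ℝ => c p.1 p.2.1 p.2.2) (X ×ˢ U ×ˢ Icc 0 T)
  terminal_cost : LocLipOn g X
  vector_field : LocLipOn (fun p : Vec n × Vec m => f p.1 p.2) (X ×ˢ U)
  compact_inputs : IsCompact U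

/-- `x` is a (Carathéodory) solution on `[0, T]` of `x'(t) = f (x t) (u t)`, `x 0 = x₀`. -/
def IsSolution {n m : ℕ} (f : Vec n → Vec m → Vec n) (T : ℝ) (x₀ : Vec n) (u : ℝ → Vec m)
    (x : ℝ → Vec n) : Prop :=
  ContinuousOn x (Icc 0 T) ∧
    IntervalIntegrable (fun s => f (x s) (u s)) volume 0 T ∧
    ∀ t ∈ Icc 0 T, x t = x₀ + ∫ s in (0 : ℝ)..t, f (x s) (u s)

open Classical in
/-- The solution map `φ_f(x₀, t, u)` of the ODE on `[0, T]` (zero if there is no solution). -/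
noncomputable def solutionMap {n m : ℕ} (f : Vec n → Vec m → Vec n) (T : ℝ) (x₀ : Vec n)
    (u : ℝ → Vec m) : ℝ → Vec n :=
  if h : ∃ x, IsSolution f T x₀ u x then Classical.choose h else fun _ => 0

/-- The inputs that are admissible for initial state `x₀` at time `0`: measurable, with values in
`U`, and having a unique solution on `[0, T]`, which stays in `X`. -/
def admissible {n m : ℕ} (X : Set (Vec n)) (U : Set (Vec m)) (f : Vec n → Vec m → Vec n) (T : ℝ)
    (x₀ : Vec n) : Set (ℝ → Vec m) :=
  {u | AEMeasurable u (volume.restrict (Icc 0 T)) ∧ (∀ t ∈ Icc 0 T, u t ∈ U) ∧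
    ∃ x, IsSolution f T x₀ u x ∧ (∀ t ∈ Icc 0 T, x t ∈ X) ∧
      ∀ y, IsSolution f T x₀ u y → EqOn y x (Icc 0 T)}

/-- The forward reachable set `FR_f(X₀, X, U, S)`. -/
def forwardReachableSet {n m : ℕ} (f : Vec n → Vec m → Vec n) (X₀ X : Set (Vec n))
    (U : Set (Vec m)) (S : Set ℝ) : Set (Vec n) :=
  {y | ∃ x ∈ X₀, ∃ T ∈ S, ∃ u ∈ admissible X U f T x, solutionMap f T x u T = y}

/-- The cost of the input `u` from initial state `x₀` at time `0`. -/
noncomputable def cost {n m : ℕ} (c : Vec n → Vec m → ℝ → ℝ) (g : Vec n → ℝ)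
    (f : Vec n → Vec m → Vec n) (T : ℝ) (x₀ : Vec n) (u : ℝ → Vec m) : ℝ :=
  (∫ s in (0 : ℝ)..T, c (solutionMap f T x₀ u s) (u s) s) + g (solutionMap f T x₀ u T)

/-- The loss `L(x₀, u)`: the cost of `u` minus the infimum of the cost over all admissible inputs.
The infimum is taken in the extended reals, so it is `-∞` if the costs are unbounded below. -/
noncomputable def loss {n m : ℕ} (c : Vec n → Vec m → ℝ → ℝ) (g : Vec n → ℝ)
    (f : Vec n → Vec m → Vec n) (X : Set (Vec n)) (U : Set (Vec m)) (T : ℝ) (x₀ : Vec n)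
    (u : ℝ → Vec m) : EReal :=
  (cost c g f T x₀ u : EReal) - ⨅ v ∈ admissible X U f T x₀, (cost c g f T x₀ v : EReal)

section Viscosity

variable {E : Type*} [NormedAddCommGroup E] [NormedSpace ℝ E]

/-- The superdifferential `D⁺y(x)` of a function on `D`; gradients are linear functionals. -/
def superdifferential (D : Set E) (y : E → ℝ) (x : E) : Set (E →L[ℝ] ℝ) :=
  {p | ∃ Φ : E → ℝ, ContDiffOn ℝ 1 Φ D ∧ HasFDerivAt Φ p x ∧
    IsLocalMaxOn (fun z => y z - Φ z) D x}

/-- The subdifferential `D⁻y(x)` of a function on `D`. -/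
def subdifferential (D : Set E) (y : E → ℝ) (x : E) : Set (E →L[ℝ] ℝ) :=
  {p | ∃ Φ : E → ℝ, ContDiffOn ℝ 1 Φ D ∧ HasFDerivAt Φ p x ∧
    IsLocalMinOn (fun z => y z - Φ z) D x}

/-- Viscosity solutions of `F(x, y(x), ∇y(x)) = 0` on the open set `D`. -/
def IsViscositySolution (F : E → ℝ → (E →L[ℝ] ℝ) → ℝ) (D : Set E) (y : E → ℝ) : Prop :=
  ContinuousOn y D ∧
    (∀ x ∈ D, ∀ p ∈ superdifferential D y x, F x (y x) p ≤ 0) ∧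
    (∀ x ∈ D, ∀ p ∈ subdifferential D y x, 0 ≤ F x (y x) p)

end Viscosity

/-- The expression `c(x, u, t) + ∇ₓW(x, t)ᵀ f(x, u)`, where `p` is the full gradient of `W` at
`(x, t)` as a linear functional: its value on `(f x u, 0)` is `∇ₓW(x, t)ᵀ f(x, u)`. -/
def hamiltonian {n m : ℕ} (c : Vec n → Vec m → ℝ → ℝ) (f : Vec n → Vec m → Vec n)
    (x : Vec n) (t : ℝ) (p : Vec n × ℝ →L[ℝ] ℝ) (u : Vec m) : ℝ :=
  c x u t + p (f x u, 0)

/-- `V` is a viscosity solution of the Hamilton-Jacobi-Bellman terminal value problem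
`∇ₜV + inf_{u ∈ U} {c(x, u, t) + ∇ₓVᵀ f(x, u)} = 0` on `ℝⁿ × (0, T)`, `V(·, T) = g`, continuous on
`ℝⁿ × [0, T]`. As usual for terminal value problems, the viscosity inequalities are those of
`-∇ₜV - inf_{u ∈ U} {...} = 0`, the form for which value functions are viscosity solutions. -/
def IsHJBViscositySolution {n m : ℕ} (c : Vec n → Vec m → ℝ → ℝ) (g : Vec n → ℝ)
    (f : Vec n → Vec m → Vec n) (U : Set (Vec m)) (T : ℝ) (V : Vec n × ℝ → ℝ) : Prop :=
  ContinuousOn V (univ ×ˢ Icc 0 T) ∧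
    IsViscositySolution
      (fun z _ p => -(p (0, 1) + ⨅ u : U, hamiltonian c f z.1 z.2 p u))
      (univ ×ˢ Ioo 0 T) V ∧
    ∀ x, V (x, T) = g x

/-- `w` is the weak derivative of `F` on the open set `D` in the direction `v`. -/
def IsWeakDeriv {n : ℕ} (D : Set (Vec n × ℝ)) (v : Vec n × ℝ) (F w : Vec n × ℝ → ℝ) : Prop :=
  LocallyIntegrableOn F D ∧ LocallyIntegrableOn w D ∧
    ∀ α : Vec n × ℝ → ℝ, ContDiff ℝ ∞ α → HasCompactSupport α → tsupport α ⊆ D →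
      ∫ z in D, F z * fderiv ℝ α z v = -∫ z in D, w z * α z

/-- The norm of `W^{1,∞}(D)` for an open set `D` of points `(x, t)`: the sum of the essential
suprema over `D` of `|F|` and of its `n + 1` weak first partial derivatives `wx i`, `wt`. It is `∞`
if some weak derivative does not exist; otherwise the infimum is over a.e. equal families. -/
noncomputable def sobolevNorm {n : ℕ} (D : Set (Vec n × ℝ)) (F : Vec n × ℝ → ℝ) : ℝ≥0∞ :=
  ⨅ (wx : Fin n → Vec n × ℝ → ℝ) (wt : Vec n × ℝ → ℝ)
    (_ : (∀ i, IsWeakDeriv D (EuclideanSpace.single i 1, 0) F (wx i)) ∧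
      IsWeakDeriv D (0, 1) F wt),
    eLpNormEssSup F (volume.restrict D) + (∑ i, eLpNormEssSup (wx i) (volume.restrict D)) +
      eLpNormEssSup wt (volume.restrict D)

/-- The constant `C = 2 max {1, T, T max_i sup_{(x, u) ∈ Ω × U} |f_i(x, u)|}`, possibly `∞`. -/
noncomputable def boundConstant {n m : ℕ} (f : Vec n → Vec m → Vec n) (Ω : Set (Vec n))
    (U : Set (Vec m)) (T : ℝ) : ℝ≥0∞ :=
  2 * max 1 (max (ENNReal.ofReal T)
    (ENNReal.ofReal T * ⨆ i : Fin n, ⨆ x ∈ Ω, ⨆ u ∈ U, ENNReal.ofReal |f x u i|))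

end OptimalControl

/-!
The loss estimate is a verification argument for `J`, with a residual measured by `V`.

Along the trajectory `x` of an admissible input `v`, the chain rule turns the cost into
`J (x₀, 0) + ∫ costRate (x s, s) (v s) ds + (g - J (·, T)) (x T)`, where
`costRate z u = c + ∇ₜJ + ∇ₓJᵀ f` (`cost_eq`). The minimum `h z` of the cost rate over `u ∈ U` is
the left side of the Hamilton-Jacobi-Bellman equation for `J`; it is a lower bound for the integrand for
every input, and equals it for the feedback input. If `|h| ≤ B` on `Ω × (0, T)` and `|J - V| ≤ M`
there, the cost of the feedback input therefore exceeds any other cost by at most `2 (M + T B)`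
(`cost_sub_cost_le`); reachability keeps all trajectories inside `Ω`, and `V (·, T) = g` controls
the terminal term.

The residual bound on `h` uses no differentiability of `V`. A continuous function with essentially
bounded weak derivatives is locally Lipschitz in each coordinate direction, with the same constants
(`IsWeakDeriv.abs_sub_le`, by mollification). Near any point, the sum of `J - V` and a steep
paraboloid has a local minimum `z`; the gradient `q` of the paraboloid at `z` inherits the Lipschitz
bounds of `J - V`, and `∇J z + q` is a supergradient of `V`. The viscosity inequality gives
`-B ≤ costRate z u` for all `u` with `B = Mₜ + ∑ᵢ sup |fᵢ| Mᵢ`, and continuity carries this to the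
original point (`neg_le_costRate`). Subgradients of `V`, together with compactness of `U`, give the
opposite bound (`exists_costRate_le`).

The convention `0 * ∞ = 0` requires a separate treatment of an unbounded vector field and vanishing
norm: then `J = V` on `Ω × (0, T)`, and the argument runs with all Lipschitz constants zero.
-/

namespace OptimalControl

/-! ### Bounded weak derivatives and Lipschitz estimates -/

section Sobolev

open Metric ContinuousLinearMap
open scoped Convolution

variable {n : ℕ} {D : Set (Vec n × ℝ)} {v : Vec n × ℝ} {F w : Vec n × ℝ → ℝ}

instance instIsAddHaarMeasureVolumeVecProdReal :
    (volume : Measure (Vec n × ℝ)).IsAddHaarMeasure :=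
  Measure.prod.instIsAddHaarMeasure volume volume

/-- The derivative along `v` of the mollification of `F` by a smooth probability density `ρ` is the
mollification of the weak derivative, hence inherits its bound. The hypothesis on `x` says that the
translated support of `ρ` stays in the domain. -/
theorem IsWeakDeriv.abs_integral_mul_fderiv_le (h : IsWeakDeriv D v F w) {M : ℝ}
    (hM : 0 ≤ M) (hw : ∀ᵐ z ∂volume.restrict D, |w z| ≤ M) {ρ : Vec n × ℝ → ℝ} (hρ : ContDiff ℝ ∞ ρ)
    (hc : HasCompactSupport ρ) (h0 : ∀ z, 0 ≤ ρ z) (h1 : ∫ z, ρ z = 1) {x : Vec n × ℝ}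
    (hx : ∀ y, x - y ∈ tsupport ρ → y ∈ D) :
    |∫ y in D, F y * fderiv ℝ ρ (x - y) v| ≤ M := by
  set α : Vec n × ℝ → ℝ := fun y => ρ (x - y) with hα
  have hαs : ContDiff ℝ ∞ α := hρ.comp (contDiff_const.sub contDiff_id)
  have hαc : HasCompactSupport α := hc.comp_homeomorph (Homeomorph.subLeft x)
  have hαt : tsupport α ⊆ D := fun y hy => hx y <|
    tsupport_comp_subset_preimage ρ (f := fun y => x - y) (by fun_prop) hy
  have hαd : ∀ y, fderiv ℝ α y v = - fderiv ℝ ρ (x - y) v := fun y => by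
    have h2 : HasFDerivAt α _ y :=
      ((hρ.differentiable (by simp)) (x - y)).hasFDerivAt.comp y
        ((hasFDerivAt_const x y).sub (hasFDerivAt_id y))
    rw [h2.fderiv]
    simp
  have key := h.2.2 α hαs hαc hαt
  simp only [hαd, mul_neg, integral_neg, neg_inj] at key
  rw [key, ← Real.norm_eq_abs]
  have hαi : Integrable α := hαs.continuous.integrable_of_hasCompactSupport hαc
  have hα1 : ∫ y in D, α y ≤ 1 := by
    rw [← h1, ← integral_sub_left_eq_self ρ volume x]
    exact setIntegral_le_integral hαi (.of_forall fun y => h0 _)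
  calc ‖∫ y in D, w y * α y‖ ≤ ∫ y in D, M * α y := by
          refine norm_integral_le_of_norm_le (hαi.integrableOn.const_mul M) ?_
          filter_upwards [hw] with y hy
          rw [norm_mul, Real.norm_eq_abs, Real.norm_eq_abs, abs_of_nonneg (h0 _ : 0 ≤ α y)]
          exact mul_le_mul_of_nonneg_right hy (h0 _)
      _ = M * ∫ y in D, α y := integral_const_mul _ _
      _ ≤ M := by nlinarith

/-- A continuous function with a weak derivative in the direction `v` bounded by `M` is
`M`-Lipschitz along `v`, on every ball whose closure lies in the domain. -/
theorem IsWeakDeriv.abs_sub_le (hD : IsOpen D) (hF : ContinuousOn F D) (h : IsWeakDeriv D v F w)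
    {M : ℝ} (hM : 0 ≤ M) (hw : ∀ᵐ z ∂volume.restrict D, |w z| ≤ M) {a : Vec n × ℝ} {r : ℝ}
    (hr : closedBall a r ⊆ D) {z : Vec n × ℝ} (hz : z ∈ ball a r) {s : ℝ}
    (hzs : z + s • v ∈ ball a r) : |F (z + s • v) - F z| ≤ M * |s| := by
  -- The convolution is taken with `F` cut off to the closed ball, which is integrable globally.
  set G : Vec n × ℝ → ℝ := (closedBall a r).indicator F
  have hGi : Integrable G :=
    (integrable_indicator_iff isClosed_closedBall.measurableSet).2
      ((hF.mono hr).integrableOn_compact (isCompact_closedBall a r))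
  have hGF : ∀ x ∈ closedBall a r, G x = F x := fun x hx => indicator_of_mem hx F
  have hGcont : ∀ x ∈ ball a r, ContinuousAt G x := fun x hx =>
    ((hF.mono hr).continuousAt (closedBall_mem_nhds_of_mem hx)).congr
      (Filter.eventuallyEq_of_mem (closedBall_mem_nhds_of_mem hx) fun y hy => (hGF y hy).symm)
  -- It suffices to compare the mollifications, which are uniformly close to `F` at both points.
  refine le_of_forall_pos_le_add fun ε hε => ?_
  obtain ⟨δ₁, hδ₁, h₁⟩ := Metric.continuousAt_iff.1 (hGcont _ hz) (ε / 2) (half_pos hε)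
  obtain ⟨δ₂, hδ₂, h₂⟩ := Metric.continuousAt_iff.1 (hGcont _ hzs) (ε / 2) (half_pos hε)
  rw [mem_ball] at hz hzs
  obtain ⟨δ, hδ, hδm⟩ : ∃ δ, 0 < δ ∧ δ ≤ min (min δ₁ δ₂) (min (r - dist z a)
      (r - dist (z + s • v) a)) :=
    ⟨_, by simp [hδ₁, hδ₂, hz, hzs], le_rfl⟩
  simp only [le_min_iff] at hδm
  obtain ⟨⟨hδ1, hδ2⟩, hδ3, hδ4⟩ := hδm
  let φ : ContDiffBump (0 : Vec n × ℝ) := ⟨δ / 2, δ, half_pos hδ, half_lt_self hδ⟩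
  set ρ := φ.normed volume with hρ
  have hρs : ContDiff ℝ ∞ ρ := φ.contDiff_normed
  have hρc : HasCompactSupport ρ := φ.hasCompactSupport_normed
  set N : Vec n × ℝ → ℝ := convolution ρ G (lsmul ℝ ℝ) volume
  have hN' : N = convolution G ρ (lsmul ℝ ℝ).flip volume := (convolution_flip _).symm
  have hd : ∀ x, ∃ N' : Vec n × ℝ →L[ℝ] ℝ, HasFDerivAt N N' x ∧
      N' v = ∫ y, G y * fderiv ℝ ρ (x - y) v := fun x => by
    refine ⟨_, hN' ▸ hρc.hasFDerivAt_convolution_right (lsmul ℝ ℝ).flip hGi.locallyIntegrable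
      (hρs.of_le (by simp)) x, ?_⟩
    rw [convolution_precompR_apply _ hGi.locallyIntegrable (hρc.fderiv ℝ)
      (hρs.continuous_fderiv (by simp))]
    simp [convolution, mul_comm]
  choose N' hNd hNv using hd
  have hbound : ∀ x ∈ closedBall a (r - δ), |N' x v| ≤ M := fun x hx => by
    have hsub : ∀ y, x - y ∈ tsupport ρ → y ∈ closedBall a r := fun y hy => by
      rw [hρ, φ.tsupport_normed_eq, mem_closedBall, dist_zero_right, ← dist_eq_norm] at hy
      rw [mem_closedBall] at hx ⊢
      have : dist x y ≤ δ := hy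
      linarith [dist_triangle_left y a x]
    rw [hNv]
    have : ∫ y, G y * fderiv ℝ ρ (x - y) v = ∫ y in D, F y * fderiv ℝ ρ (x - y) v := by
      rw [← integral_indicator hD.measurableSet]
      congr 1 with y
      by_cases hy : x - y ∈ tsupport ρ
      · rw [indicator_of_mem (hr (hsub y hy)), hGF y (hsub y hy)]
      · have h0 : fderiv ℝ ρ (x - y) = 0 :=
          image_eq_zero_of_notMem_tsupport fun hy' => hy (tsupport_fderiv_subset ℝ hy')
        simp [indicator, h0]
    rw [this]
    exact h.abs_integral_mul_fderiv_le hM hw hρs hρc φ.nonneg_normed φ.integral_normed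
      fun y hy => hr (hsub y hy)
  have hline : ∀ τ ∈ Icc (0 : ℝ) 1, z + (τ * s) • v ∈ closedBall a (r - δ) := fun τ hτ => by
    have := (convex_closedBall a (r - δ)).add_smul_sub_mem (x := z) (y := z + s • v)
      (by rw [mem_closedBall]; linarith) (by rw [mem_closedBall]; linarith) hτ
    simpa [mul_smul] using this
  have hNl : |N (z + s • v) - N z| ≤ M * |s| := by
    have h3 : ∀ τ ∈ Icc (0 : ℝ) 1, HasDerivWithinAt (fun τ : ℝ => N (z + (τ * s) • v))
        (N' (z + (τ * s) • v) (s • v)) (Icc 0 1) τ := fun τ _ => by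
      have h4 : HasDerivAt (fun τ : ℝ => z + (τ * s) • v) (s • v) τ := by
        simpa using ((hasDerivAt_mul_const s).smul_const v).const_add z
      exact ((hNd _).comp_hasDerivAt τ h4).hasDerivWithinAt
    have := norm_image_sub_le_of_norm_deriv_le_segment_01' h3 (C := M * |s|) fun τ hτ => by
      rw [map_smul, smul_eq_mul, norm_mul, mul_comm, Real.norm_eq_abs, Real.norm_eq_abs]
      exact mul_le_mul_of_nonneg_right (hbound _ (hline τ (Ico_subset_Icc_self hτ))) (abs_nonneg s)
    simpa using this
  have e1 : dist (N z) (G z) ≤ ε / 2 :=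
    φ.dist_normed_convolution_le hGi.aestronglyMeasurable fun x hx =>
      (h₁ (lt_of_lt_of_le (mem_ball.1 hx) hδ1)).le
  have e2 : dist (N (z + s • v)) (G (z + s • v)) ≤ ε / 2 :=
    φ.dist_normed_convolution_le hGi.aestronglyMeasurable fun x hx =>
      (h₂ (lt_of_lt_of_le (mem_ball.1 hx) hδ2)).le
  rw [hGF z hz.le, Real.dist_eq] at e1
  rw [hGF (z + s • v) hzs.le, Real.dist_eq] at e2
  rw [abs_le] at *
  constructor <;> linarith [e1.1, e1.2, e2.1, e2.2, hNl.1, hNl.2]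

/-- A continuous function bounded almost everywhere on an open set is bounded there everywhere. -/
theorem abs_le_of_ae_restrict (hD : IsOpen D) (hF : ContinuousOn F D) {M : ℝ}
    (h : ∀ᵐ z ∂volume.restrict D, |F z| ≤ M) {z : Vec n × ℝ} (hz : z ∈ D) : |F z| ≤ M := by
  by_contra! hlt
  have hopen : IsOpen (D ∩ (fun y => |F y|) ⁻¹' Ioi M) := hF.abs.isOpen_inter_preimage hD isOpen_Ioi
  refine (hopen.measure_pos volume ⟨z, hz, hlt⟩).ne' ?_
  rw [ae_restrict_iff' hD.measurableSet] at h
  refine measure_mono_null ?_ (ae_iff.1 h)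
  exact fun y hy hy' => (hy' hy.1).not_gt hy.2

end Sobolev

/-! ### Trajectories of the control system -/

theorem LocLipOn.continuousOn {X Y : Type*} [PseudoMetricSpace X] [ProperSpace X]
    [PseudoMetricSpace Y] {F : X → Y} {S : Set X} (hF : LocLipOn F S) (hS : IsClosed S) :
    ContinuousOn F S := fun p hp => by
  obtain ⟨L, hL⟩ := hF (Metric.closedBall p 1 ∩ S) inter_subset_right
    ((isCompact_closedBall p 1).inter_right hS)
  have hp1 : p ∈ Metric.closedBall p 1 := Metric.mem_closedBall_self zero_le_one
  exact (hL.continuousOn p ⟨hp1, hp⟩).mono_of_mem_nhdsWithin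
    (Filter.inter_mem (mem_nhdsWithin_of_mem_nhds (Metric.closedBall_mem_nhds p one_pos))
      self_mem_nhdsWithin)

section Dynamics

variable {n m : ℕ} {f : Vec n → Vec m → Vec n} {U : Set (Vec m)} {T : ℝ} {x₀ : Vec n}
  {u : ℝ → Vec m} {x y : ℝ → Vec n}

theorem IsSolution.mono (hx : IsSolution f T x₀ u x) {S : ℝ} (hS : S ∈ Icc 0 T) :
    IsSolution f S x₀ u x :=
  have hsub : Icc 0 S ⊆ Icc 0 T := Icc_subset_Icc_right hS.2
  ⟨hx.1.mono hsub, hx.2.1.mono_set (by rwa [uIcc_of_le hS.1, uIcc_of_le (hS.1.trans hS.2)]),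
    fun t ht => hx.2.2 t (hsub ht)⟩

theorem IsSolution.apply_zero (hx : IsSolution f T x₀ u x) (hT : 0 ≤ T) : x 0 = x₀ := by
  simpa using hx.2.2 0 ⟨le_rfl, hT⟩

/-- Solutions for a locally Lipschitz vector field and a compact input set are unique. Grönwall's
argument: the maximum of the distance of two solutions, in the norm weighted by `exp (-b t)`
with `b` large against the Lipschitz constant, is at most half of itself. -/
theorem IsSolution.eqOn (hf : LocLipOn (fun p : Vec n × Vec m => f p.1 p.2) (univ ×ˢ U))
    (hU : IsCompact U) (hu : ∀ t ∈ Icc 0 T, u t ∈ U) (hx : IsSolution f T x₀ u x)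
    (hy : IsSolution f T x₀ u y) : EqOn y x (Icc 0 T) := by
  rcases lt_or_ge T 0 with hT | hT
  · simp [Icc_eq_empty hT.not_ge]
  have hK : IsCompact (((x '' Icc 0 T) ∪ (y '' Icc 0 T)) ×ˢ U) :=
    ((isCompact_Icc.image_of_continuousOn hx.1).union
      (isCompact_Icc.image_of_continuousOn hy.1)).prod hU
  obtain ⟨L, hL⟩ := hf _ (prod_mono_left (subset_univ _)) hK
  set b : ℝ := 2 * L + 1 with hb
  have hb0 : 0 < b := by positivity
  obtain ⟨τ, hτ, hmax⟩ := isCompact_Icc.exists_isMaxOn (nonempty_Icc.2 hT)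
    (f := fun t => Real.exp (-(b * t)) * ‖y t - x t‖)
    ((by fun_prop : Continuous fun t : ℝ => Real.exp (-(b * t))).continuousOn.mul
      (hy.1.sub hx.1).norm)
  set A := Real.exp (-(b * τ)) * ‖y τ - x τ‖ with hA
  have hdist : ∀ t ∈ Icc 0 T, ‖y t - x t‖ ≤ A * Real.exp (b * t) := fun t ht => by
    have : Real.exp (-(b * t)) * ‖y t - x t‖ ≤ A := hmax ht
    rwa [Real.exp_neg, inv_mul_le_iff₀ (Real.exp_pos _), mul_comm] at this
  have hA0 : 0 ≤ A := by positivity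
  have hlip : ∀ t ∈ Icc 0 T, ‖f (y t) (u t) - f (x t) (u t)‖ ≤ L * (A * Real.exp (b * t)) :=
    fun t ht => by
      have h1 := hL.norm_sub_le (x := (y t, u t)) (y := (x t, u t))
        ⟨.inr (mem_image_of_mem y ht), hu t ht⟩ ⟨.inl (mem_image_of_mem x ht), hu t ht⟩
      simp only [Prod.mk_sub_mk, sub_self, Prod.norm_mk, norm_zero, norm_nonneg,
        max_eq_left] at h1
      exact h1.trans (mul_le_mul_of_nonneg_left (hdist t ht) L.2)
  have hint : ∀ s, HasDerivAt (fun s => L * A / b * Real.exp (b * s))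
      (L * (A * Real.exp (b * s))) s := fun s => by
    have := (((hasDerivAt_id s).const_mul b).exp).const_mul (L * A / b)
    convert! this using 1
    simp only [id]
    field_simp
  have hτ' := hx.mono hτ
  have hτy := hy.mono hτ
  have key : ‖y τ - x τ‖ ≤ L * A / b * Real.exp (b * τ) := by
    rw [hx.2.2 τ hτ, hy.2.2 τ hτ, add_sub_add_left_eq_sub,
      ← intervalIntegral.integral_sub hτy.2.1 hτ'.2.1]
    have hcont : Continuous fun s => (L : ℝ) * (A * Real.exp (b * s)) := by fun_prop
    refine (intervalIntegral.norm_integral_le_of_norm_le hτ.1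
      (.of_forall fun t ht => hlip t ⟨ht.1.le, ht.2.trans hτ.2⟩)
      (hcont.intervalIntegrable _ _)).trans ?_
    rw [intervalIntegral.integral_eq_sub_of_hasDerivAt (fun s _ => hint s)
      (hcont.intervalIntegrable _ _)]
    have : 0 ≤ L * A / b * Real.exp (b * 0) := by positivity
    linarith
  have hA' : A ≤ L * A / b := by
    refine hA.trans_le ?_
    rw [Real.exp_neg, inv_mul_le_iff₀ (Real.exp_pos _), mul_comm]
    exact key
  have hA1 : A = 0 := by
    rw [le_div_iff₀ hb0] at hA'
    have := mul_nonneg L.2 hA0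
    nlinarith [this, show (L : ℝ) * A = L.1 * A from rfl]
  intro t ht
  have := hdist t ht
  rw [hA1, zero_mul, norm_le_zero_iff, sub_eq_zero] at this
  exact this

theorem isSolution_solutionMap (hu : u ∈ admissible univ U f T x₀) :
    IsSolution f T x₀ u (solutionMap f T x₀ u) := by
  obtain ⟨-, -, x, hx, -⟩ := hu
  have h : ∃ x, IsSolution f T x₀ u x := ⟨x, hx⟩
  rw [solutionMap, dif_pos h]
  exact Classical.choose_spec h

/-- Every state on an admissible trajectory is reachable: the restriction of an admissible input
to a shorter interval is again admissible. -/
theorem solutionMap_mem_forwardReachableSet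
    (hf : LocLipOn (fun p : Vec n × Vec m => f p.1 p.2) (univ ×ˢ U)) (hU : IsCompact U)
    (hu : u ∈ admissible univ U f T x₀) {t : ℝ} (ht : t ∈ Icc 0 T) :
    solutionMap f T x₀ u t ∈ forwardReachableSet f {x₀} univ U (Icc 0 T) := by
  have hsub : Icc 0 t ⊆ Icc 0 T := Icc_subset_Icc_right ht.2
  have hx := (isSolution_solutionMap hu).mono ht
  have hut : ∀ s ∈ Icc 0 t, u s ∈ U := fun s hs => hu.2.1 s (hsub hs)
  have hadm : u ∈ admissible univ U f t x₀ :=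
    ⟨hu.1.mono_measure (Measure.restrict_mono_set _ hsub), hut, _, hx, fun _ _ => mem_univ _,
      fun y hy => hx.eqOn hf hU hut hy⟩
  exact ⟨x₀, rfl, t, ht, u, hadm, hx.eqOn hf hU hut (isSolution_solutionMap hadm) ⟨ht.1, le_rfl⟩⟩

/-- The chain rule along a trajectory with bounded velocity, in integrated form. The trajectory is
Lipschitz, hence `J` is absolutely continuous along it. -/
theorem IsSolution.integral_fderiv (hT : 0 ≤ T) (hx : IsSolution f T x₀ u x) {B : ℝ≥0}
    (hB : ∀ t ∈ Icc 0 T, ‖f (x t) (u t)‖ ≤ B) {J : Vec n × ℝ → ℝ} (hJ : ContDiff ℝ 1 J) :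
    IntervalIntegrable (fun t => fderiv ℝ J (x t, t) (f (x t) (u t), 1)) volume 0 T ∧
      ∫ t in (0 : ℝ)..T, fderiv ℝ J (x t, t) (f (x t) (u t), 1) = J (x T, T) - J (x₀, 0) := by
  have hxl : LipschitzOnWith B x (Icc 0 T) := by
    rw [lipschitzOnWith_iff_norm_sub_le]
    intro t ht s hs
    have hts : uIcc s t ⊆ uIcc 0 T := by
      rw [uIcc_of_le hT]
      exact ordConnected_Icc.uIcc_subset hs ht
    have hint : ∀ r ∈ Icc 0 T, IntervalIntegrable (fun s => f (x s) (u s)) volume 0 r :=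
      fun r hr => (hx.mono hr).2.1
    rw [hx.2.2 t ht, hx.2.2 s hs, add_sub_add_left_eq_sub,
      intervalIntegral.integral_interval_sub_left (hint t ht) (hint s hs)]
    refine intervalIntegral.norm_integral_le_of_norm_le_const fun r hr => hB r ?_
    rw [← uIcc_of_le hT]
    exact hts (uIoc_subset_uIcc hr)
  have hγ : LipschitzOnWith (max B 1) (fun t => (x t, t)) (Icc 0 T) :=
    hxl.prodMk (LipschitzWith.id.lipschitzOnWith)
  obtain ⟨R, hR⟩ :=
    (isCompact_Icc.image_of_continuousOn hγ.continuousOn).isBounded.subset_closedBall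
      (0 : Vec n × ℝ)
  obtain ⟨L, hL⟩ := hJ.contDiffOn.exists_lipschitzOnWith one_ne_zero
    (convex_closedBall (0 : Vec n × ℝ) R) (isCompact_closedBall _ _)
  have hac : AbsolutelyContinuousOnInterval (fun t => J (x t, t)) 0 T := by
    refine LipschitzOnWith.absolutelyContinuousOnInterval (K := L * max B 1) ?_
    rw [uIcc_of_le hT]
    exact hL.comp hγ fun t ht => hR (mem_image_of_mem _ ht)
  have hae : ∀ᵐ t, t ∈ uIoc 0 T →
      deriv (fun t => J (x t, t)) t = fderiv ℝ J (x t, t) (f (x t) (u t), 1) := by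
    filter_upwards [hx.2.1.ae_hasDerivAt_integral, Measure.ae_ne volume T] with t ht htT htI
    rw [uIoc_of_le hT] at htI
    have htI' : t ∈ Ioo 0 T := ⟨htI.1, htI.2.lt_of_ne htT⟩
    have h1 : HasDerivAt x (f (x t) (u t)) t := by
      refine ((ht (by rw [uIcc_of_le hT]; exact Ioo_subset_Icc_self htI') 0 left_mem_uIcc).const_add
        x₀).congr_of_eventuallyEq ?_
      filter_upwards [Icc_mem_nhds htI'.1 htI'.2] with s hs using hx.2.2 s hs
    exact ((hJ.differentiable one_ne_zero _).hasFDerivAt.comp_hasDerivAt t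
      (h1.prodMk (hasDerivAt_id t))).deriv
  refine ⟨hac.intervalIntegrable_deriv.congr_ae ((ae_restrict_iff' measurableSet_uIoc).2 hae), ?_⟩
  rw [← intervalIntegral.integral_congr_ae hae, hac.integral_deriv_eq_sub, hx.apply_zero hT]

/-- The running cost is integrable along a trajectory. -/
theorem IsSolution.intervalIntegrable_cost {c : Vec n → Vec m → ℝ → ℝ}
    (hc : ContinuousOn (fun p : Vec n × Vec m × ℝ => c p.1 p.2.1 p.2.2) (univ ×ˢ U ×ˢ Icc 0 T))
    (hU : IsCompact U) (hT : 0 ≤ T) (hum : AEMeasurable u (volume.restrict (Icc 0 T)))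
    (hu : ∀ t ∈ Icc 0 T, u t ∈ U) (hx : IsSolution f T x₀ u x) :
    IntervalIntegrable (fun s => c (x s) (u s) s) volume 0 T := by
  rw [intervalIntegrable_iff_integrableOn_Icc_of_le hT]
  have hS : MeasurableSet ((univ : Set (Vec n)) ×ˢ U ×ˢ Icc 0 T) :=
    MeasurableSet.univ.prod (hU.measurableSet.prod measurableSet_Icc)
  obtain ⟨A, hA⟩ := ((isCompact_Icc.image_of_continuousOn hx.1).prod
    (hU.prod isCompact_Icc)).exists_bound_of_continuousOn
      (hc.mono (prod_mono_left (subset_univ _)))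
  have hmem : ∀ᵐ s ∂volume.restrict (Icc 0 T), s ∈ Icc 0 T := ae_restrict_mem measurableSet_Icc
  have hp : AEMeasurable (fun s => (x s, u s, s)) (volume.restrict (Icc 0 T)) :=
    (hx.1.aemeasurable measurableSet_Icc).prodMk (hum.prodMk aemeasurable_id)
  classical
  have hcm := (hc.measurable_piecewise (continuous_zero.continuousOn) hS).comp_aemeasurable hp
  refine Integrable.of_bound (hcm.aestronglyMeasurable.congr ?_) A ?_
  · filter_upwards [hmem] with s hs
    exact piecewise_eq_of_mem _ _ _ ⟨mem_univ _, hu s hs, hs⟩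
  · filter_upwards [hmem] with s hs
    exact hA (x s, u s, s) ⟨mem_image_of_mem x hs, hu s hs, hs⟩

end Dynamics

/-! ### The Hamilton-Jacobi-Bellman residual of a smooth function -/

section Touching

open Filter Topology

variable {E : Type*} [NormedAddCommGroup E] [NormedSpace ℝ E] {F θ : E → ℝ} {q : E →L[ℝ] ℝ}
  {z v : E} {M : ℝ}

theorem neg_le_of_isLocalMin_add (hmin : IsLocalMin (fun y => F y + θ y) z)
    (hθ : HasFDerivAt θ q z) (hF : ∀ᶠ s : ℝ in 𝓝 0, |F (z + s • v) - F z| ≤ M * |s|) :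
    -M ≤ q v := by
  have hline : HasDerivAt (fun s : ℝ => z + s • v) v 0 := by
    simpa using ((hasDerivAt_id (0 : ℝ)).smul_const v).const_add z
  have hd : HasDerivAt (fun s : ℝ => θ (z + s • v)) (q v) 0 :=
    HasFDerivAt.comp_hasDerivAt (0 : ℝ) (by simpa using hθ) hline
  have hlim : Tendsto (fun s : ℝ => z + s • v) (𝓝 0) (𝓝 z) := by
    simpa using hline.continuousAt.tendsto
  have hslope : Tendsto (slope (fun s : ℝ => θ (z + s • v)) 0) (𝓝[>] 0) (𝓝 (q v)) :=
    (hasDerivAt_iff_tendsto_slope.1 hd).mono_left (nhdsWithin_mono _ fun s (hs : 0 < s) => hs.ne')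
  refine ge_of_tendsto hslope ?_
  filter_upwards [nhdsWithin_le_nhds hF, nhdsWithin_le_nhds (hlim.eventually hmin),
    self_mem_nhdsWithin] with s h1 h2 hs
  have hs : 0 < s := hs
  rw [slope_def_field, sub_zero, le_div_iff₀ hs]
  rw [abs_of_pos hs] at h1
  simp only [zero_smul, add_zero]
  linarith [le_abs_self (F (z + s • v) - F z)]

/-- A smooth function touching an `M`-Lipschitz function has slopes bounded by `M`; only the
Lipschitz condition in one direction is used, for the slope in that direction. -/
theorem abs_le_of_isLocalMin_add (hmin : IsLocalMin (fun y => F y + θ y) z)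
    (hθ : HasFDerivAt θ q z) (hF : ∀ᶠ s : ℝ in 𝓝 0, |F (z + s • v) - F z| ≤ M * |s|) :
    |q v| ≤ M := by
  refine abs_le.2 ⟨neg_le_of_isLocalMin_add hmin hθ hF, ?_⟩
  have hneg : Tendsto (fun s : ℝ => -s) (𝓝 0) (𝓝 0) := by simpa using tendsto_neg (0 : ℝ)
  have := neg_le_of_isLocalMin_add (v := -v) (M := M) hmin hθ
    ((hneg.eventually hF).mono fun s hs => by simpa using hs)
  rw [map_neg] at this
  linarith

/-- The points at which a continuous function is touched from below by a smooth function are dense: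
after a steep paraboloid centred at `a` is added, the minimum over a small ball is interior. -/
theorem exists_isLocalMin_add {n : ℕ} {D : Set (Vec n × ℝ)} (hD : IsOpen D)
    {F : Vec n × ℝ → ℝ} (hF : ContinuousOn F D) {a : Vec n × ℝ} (ha : a ∈ D) {δ : ℝ} (hδ : 0 < δ) :
    ∃ z ∈ D ∩ Metric.ball a δ, ∃ θ : Vec n × ℝ → ℝ, ContDiff ℝ 1 θ ∧
      IsLocalMin (fun y => F y + θ y) z := by
  obtain ⟨ε, hε, hεD⟩ := Metric.nhds_basis_closedBall.mem_iff.1 (hD.mem_nhds ha)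
  set r := min ε (δ / 2)
  have hr0 : 0 < r := lt_min hε (half_pos hδ)
  have hrD : Metric.closedBall a r ⊆ D :=
    (Metric.closedBall_subset_closedBall (min_le_left _ _)).trans hεD
  obtain ⟨A, hA⟩ := (isCompact_closedBall a r).exists_bound_of_continuousOn (hF.mono hrD)
  have haA := hA a (Metric.mem_closedBall_self hr0.le)
  set ψ : Vec n × ℝ → ℝ := fun y => ‖y.1 - a.1‖ ^ 2 + (y.2 - a.2) ^ 2 with hψ
  -- On the sphere of radius `r` this factor lifts `F` from at least `-A` to at least `A + 1`.
  set lam : ℝ := (2 * A + 1) / r ^ 2 with hlam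
  have hA0 : 0 ≤ A := (norm_nonneg _).trans haA
  have hψs : ContDiff ℝ 1 ψ :=
    ((contDiff_fst.sub contDiff_const).norm_sq ℝ).add ((contDiff_snd.sub contDiff_const).pow 2)
  have hθs : ContDiff ℝ 1 fun y => lam * ψ y := contDiff_const.mul hψs
  obtain ⟨z, hz, hmin⟩ := Metric.exists_isLocalMin_mem_ball (a := a) (z := a) (r := r)
    (f := fun y => F y + lam * ψ y) ((hF.mono hrD).add hθs.continuous.continuousOn)
    (Metric.mem_closedBall_self hr0.le) fun y hy => by
      have hy1 : r ^ 2 ≤ ψ y := by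
        rw [Metric.mem_sphere, Prod.dist_eq, dist_eq_norm, dist_eq_norm] at hy
        rcases max_choice ‖y.1 - a.1‖ ‖y.2 - a.2‖ with h | h
        · rw [h] at hy
          rw [hψ, ← hy]
          nlinarith [sq_nonneg (y.2 - a.2)]
        · rw [h, Real.norm_eq_abs] at hy
          rw [hψ, ← hy, sq_abs]
          nlinarith [sq_nonneg ‖y.1 - a.1‖]
      have hy2 : 2 * A + 1 ≤ lam * ψ y := by
        rw [hlam, div_mul_eq_mul_div, le_div_iff₀ (by positivity)]
        exact mul_le_mul_of_nonneg_left hy1 (by positivity)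
      have hyA := hA y (Metric.sphere_subset_closedBall hy)
      rw [Real.norm_eq_abs, abs_le] at haA hyA
      have : ψ a = 0 := by simp [hψ]
      simp only [this, mul_zero, add_zero]
      linarith [haA.2, hyA.1]
  refine ⟨z, ⟨hrD (Metric.ball_subset_closedBall hz), Metric.ball_subset_ball ?_ hz⟩, _, hθs, hmin⟩
  exact (min_le_right _ _).trans (half_le_self hδ.le)

end Touching

section Residual

open Filter Topology

variable {n m : ℕ} {c : Vec n → Vec m → ℝ → ℝ} {g : Vec n → ℝ} {f : Vec n → Vec m → Vec n}
  {U : Set (Vec m)} {T : ℝ} {J V : Vec n × ℝ → ℝ} {Ω : Set (Vec n)} {Mx : Fin n → ℝ} {Mt B : ℝ}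

/-- The running cost plus the rate of change of `J` along a trajectory that passes through `z` with
input `u`. Its minimum over `u` is the left side of the Hamilton-Jacobi-Bellman equation for `J`. -/
noncomputable def costRate (c : Vec n → Vec m → ℝ → ℝ) (f : Vec n → Vec m → Vec n)
    (J : Vec n × ℝ → ℝ) (z : Vec n × ℝ) (u : Vec m) : ℝ :=
  c z.1 u z.2 + fderiv ℝ J z (f z.1 u, 1)

theorem apply_add_hamiltonian (x : Vec n) (t : ℝ) (p : Vec n × ℝ →L[ℝ] ℝ) (u : Vec m) :
    p (0, 1) + hamiltonian c f x t p u = c x u t + p (f x u, 1) := by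
  have : ((f x u, 1) : Vec n × ℝ) = (0, 1) + (f x u, 0) := by simp
  rw [this, map_add, hamiltonian]
  ring

theorem continuousOn_costRate
    (hc : ContinuousOn (fun p : Vec n × Vec m × ℝ => c p.1 p.2.1 p.2.2) (univ ×ˢ U ×ˢ Icc 0 T))
    (hf : ContinuousOn (fun p : Vec n × Vec m => f p.1 p.2) (univ ×ˢ U)) (hJ : ContDiff ℝ 1 J) :
    ContinuousOn (fun p : (Vec n × ℝ) × Vec m => costRate c f J p.1 p.2)
      ((univ ×ˢ Icc 0 T) ×ˢ U) := by
  have h1 : ContinuousOn (fun p : (Vec n × ℝ) × Vec m => c p.1.1 p.2 p.1.2)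
      ((univ ×ˢ Icc 0 T) ×ˢ U) :=
    hc.comp (f := fun p : (Vec n × ℝ) × Vec m => (p.1.1, p.2, p.1.2)) (by fun_prop)
      fun p hp => ⟨mem_univ _, hp.2, hp.1.2⟩
  have h2 : ContinuousOn (fun p : (Vec n × ℝ) × Vec m => f p.1.1 p.2)
      ((univ ×ˢ Icc 0 T) ×ˢ U) :=
    hf.comp (f := fun p : (Vec n × ℝ) × Vec m => (p.1.1, p.2)) (by fun_prop)
      fun p hp => ⟨mem_univ _, hp.2⟩
  exact h1.add ((((hJ.continuous_fderiv one_ne_zero).comp continuous_fst).continuousOn).clm_apply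
    (h2.prodMk continuousOn_const))

theorem abs_apply_le {q : Vec n × ℝ →L[ℝ] ℝ}
    (hqx : ∀ i, |q (EuclideanSpace.single i 1, 0)| ≤ Mx i) (hqt : |q (0, 1)| ≤ Mt) (w : Vec n) :
    |q (w, 1)| ≤ Mt + ∑ i, |w i| * Mx i := by
  have hw : ((w, 1) : Vec n × ℝ) =
      (0, 1) + ∑ i, w i • ((EuclideanSpace.single i 1, 0) : Vec n × ℝ) := by
    refine Prod.ext ?_ ?_
    · rw [Prod.fst_add, Prod.fst_sum]
      ext j
      simp [Finset.sum_apply, Pi.single_apply]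
    · simp [Prod.snd_sum]
  rw [hw, map_add, map_sum]
  refine (abs_add_le _ _).trans (add_le_add hqt ((Finset.abs_sum_le_sum_abs _ _).trans
    (Finset.sum_le_sum fun i _ => ?_)))
  rw [map_smul, smul_eq_mul, abs_mul]
  exact mul_le_mul_of_nonneg_left (hqx i) (abs_nonneg _)

/-- Lipschitz bounds for `F` near each point of `D`, in the coordinate directions: `Mx i` for the
`i`-th space direction and `Mt` for time. -/
def HasCoordLipBounds (D : Set (Vec n × ℝ)) (F : Vec n × ℝ → ℝ) (Mx : Fin n → ℝ) (Mt : ℝ) : Prop :=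
  ∀ z ∈ D,
    (∀ i, ∀ᶠ s : ℝ in 𝓝 0,
      |F (z + s • (EuclideanSpace.single i 1, 0)) - F z| ≤ Mx i * |s|) ∧
    ∀ᶠ s : ℝ in 𝓝 0, |F (z + s • (0, 1)) - F z| ≤ Mt * |s|

theorem HasCoordLipBounds.neg {D : Set (Vec n × ℝ)} {F : Vec n × ℝ → ℝ}
    (h : HasCoordLipBounds D F Mx Mt) : HasCoordLipBounds D (fun z => -F z) Mx Mt := fun z hz =>
  ⟨fun i => ((h z hz).1 i).mono fun s hs => by rwa [neg_sub_neg, abs_sub_comm],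
    (h z hz).2.mono fun s hs => by rwa [neg_sub_neg, abs_sub_comm]⟩

theorem HasCoordLipBounds.abs_fderiv_le {D : Set (Vec n × ℝ)} {F θ : Vec n × ℝ → ℝ}
    (h : HasCoordLipBounds D F Mx Mt) {z : Vec n × ℝ} (hz : z ∈ D)
    (hθ : ContDiff ℝ 1 θ) (hmin : IsLocalMin (fun y => F y + θ y) z) (w : Vec n) :
    |fderiv ℝ θ z (w, 1)| ≤ Mt + ∑ i, |w i| * Mx i :=
  have hd := (hθ.differentiable one_ne_zero z).hasFDerivAt
  abs_apply_le (fun i => abs_le_of_isLocalMin_add hmin hd ((h z hz).1 i))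
    (abs_le_of_isLocalMin_add hmin hd (h z hz).2) w

/-- The lower half of the residual estimate comes from the superdifferential of `V` at the points
where `J + θ - V` has a local minimum; these are dense, and the cost rate is continuous. -/
theorem neg_le_costRate
    (hc : ContinuousOn (fun p : Vec n × Vec m × ℝ => c p.1 p.2.1 p.2.2) (univ ×ˢ U ×ˢ Icc 0 T))
    (hf : ContinuousOn (fun p : Vec n × Vec m => f p.1 p.2) (univ ×ˢ U)) (hU : IsCompact U)
    (hJ : ContDiff ℝ 1 J) (hΩ : IsOpen Ω) (hV : IsHJBViscositySolution c g f U T V)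
    (hF : HasCoordLipBounds (Ω ×ˢ Ioo 0 T) (fun z => J z - V z) Mx Mt)
    (hB : ∀ x ∈ Ω, ∀ u ∈ U, Mt + ∑ i, |f x u i| * Mx i ≤ B)
    {z₀ : Vec n × ℝ} (hz₀ : z₀ ∈ Ω ×ˢ Ioo 0 T) {u : Vec m} (hu : u ∈ U) :
    -B ≤ costRate c f J z₀ u := by
  have hD : IsOpen (Ω ×ˢ Ioo (0 : ℝ) T) := hΩ.prod isOpen_Ioo
  have hDI : Ω ×ˢ Ioo (0 : ℝ) T ⊆ univ ×ˢ Icc 0 T := prod_mono (subset_univ _) Ioo_subset_Icc_self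
  have hFc : ContinuousOn (fun z => J z - V z) (Ω ×ˢ Ioo 0 T) :=
    hJ.continuous.continuousOn.sub (hV.1.mono hDI)
  have hcont : ContinuousOn (fun z => costRate c f J z u) (Ω ×ˢ Ioo 0 T) :=
    (continuousOn_costRate hc hf hJ).comp (f := fun z => (z, u)) (by fun_prop)
      fun z hz => ⟨hDI hz, hu⟩
  refine le_of_forall_pos_lt_add fun ε hε => ?_
  obtain ⟨δ, hδ, hδc⟩ := Metric.continuousOn_iff.1 hcont z₀ hz₀ ε hε
  obtain ⟨z, ⟨hzD, hzδ⟩, θ, hθ, hmin⟩ := exists_isLocalMin_add hD hFc hz₀ hδ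
  have hθz := hF.abs_fderiv_le hzD hθ hmin (f z.1 u)
  have hp : fderiv ℝ J z + fderiv ℝ θ z ∈ superdifferential (univ ×ˢ Ioo 0 T) V z := by
    refine ⟨fun y => J y + θ y, (hJ.add hθ).contDiffOn,
      (hJ.differentiable one_ne_zero z).hasFDerivAt.add
        (hθ.differentiable one_ne_zero z).hasFDerivAt, ?_⟩
    refine IsLocalMax.on ?_ _
    filter_upwards [hmin] with y hy
    linarith
  have h1 := hV.2.1.2.1 z ⟨mem_univ _, hzD.2⟩ _ hp
  set p := fderiv ℝ J z + fderiv ℝ θ z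
  have hbdd : BddBelow (range fun u : U => hamiltonian c f z.1 z.2 p u) := by
    have hh : ContinuousOn (hamiltonian c f z.1 z.2 p) U :=
      (hc.comp (f := fun u => (z.1, u, z.2)) (by fun_prop)
        fun u hu => ⟨mem_univ _, hu, (hDI hzD).2⟩).add
      (p.continuous.comp_continuousOn ((hf.comp (f := fun u => (z.1, u)) (by fun_prop)
        fun u hu => ⟨mem_univ _, hu⟩).prodMk continuousOn_const))
    have := (hU.image_of_continuousOn hh).bddBelow
    rwa [image_eq_range] at this
  have h2 := ciInf_le hbdd ⟨u, hu⟩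
  have h3 := apply_add_hamiltonian (c := c) (f := f) z.1 z.2 p u
  have h4 : p (f z.1 u, 1) = fderiv ℝ J z (f z.1 u, 1) + fderiv ℝ θ z (f z.1 u, 1) := rfl
  have h5 := hδc z hzD hzδ
  rw [Real.dist_eq, abs_lt] at h5
  have h6 := hB z.1 hzD.1 u hu
  have h7 : costRate c f J z u = c z.1 u z.2 + fderiv ℝ J z (f z.1 u, 1) := rfl
  linarith [h5.2, le_abs_self (fderiv ℝ θ z (f z.1 u, 1))]

/-- The upper half of the residual estimate, from the subdifferential of `V`. Compactness of `U`
makes the set of states at which some input has cost rate at most `B` closed. -/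
theorem exists_costRate_le
    (hc : ContinuousOn (fun p : Vec n × Vec m × ℝ => c p.1 p.2.1 p.2.2) (univ ×ˢ U ×ˢ Icc 0 T))
    (hf : ContinuousOn (fun p : Vec n × Vec m => f p.1 p.2) (univ ×ˢ U)) (hU : IsCompact U)
    (hUne : U.Nonempty)
    (hJ : ContDiff ℝ 1 J) (hΩ : IsOpen Ω) (hV : IsHJBViscositySolution c g f U T V)
    (hF : HasCoordLipBounds (Ω ×ˢ Ioo 0 T) (fun z => J z - V z) Mx Mt)
    (hB : ∀ x ∈ Ω, ∀ u ∈ U, Mt + ∑ i, |f x u i| * Mx i ≤ B)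
    {z₀ : Vec n × ℝ} (hz₀ : z₀ ∈ Ω ×ˢ Ioo 0 T) :
    ∃ u ∈ U, costRate c f J z₀ u ≤ B := by
  have hD : IsOpen (Ω ×ˢ Ioo (0 : ℝ) T) := hΩ.prod isOpen_Ioo
  have hDI : Ω ×ˢ Ioo (0 : ℝ) T ⊆ univ ×ˢ Icc 0 T := prod_mono (subset_univ _) Ioo_subset_Icc_self
  have hFc : ContinuousOn (fun z => -(J z - V z)) (Ω ×ˢ Ioo 0 T) :=
    (hJ.continuous.continuousOn.sub (hV.1.mono hDI)).neg
  have hrate := continuousOn_costRate hc hf hJ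
  obtain ⟨r, hr, hrD⟩ := Metric.nhds_basis_closedBall.mem_iff.1 (hD.mem_nhds hz₀)
  have hK : IsCompact (Metric.closedBall z₀ r ×ˢ U) := (isCompact_closedBall z₀ r).prod hU
  have hKc : IsClosed (Prod.fst '' ((Metric.closedBall z₀ r ×ˢ U) ∩
      (fun p : (Vec n × ℝ) × Vec m => costRate c f J p.1 p.2) ⁻¹' Iic B)) := by
    refine IsCompact.isClosed (IsCompact.image (hK.of_isClosed_subset ?_ inter_subset_left)
      continuous_fst)
    exact (hrate.mono (prod_mono_left (hrD.trans hDI))).preimage_isClosed_of_isClosed hK.isClosed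
      isClosed_Iic
  suffices hmem : z₀ ∈ closure (Prod.fst '' ((Metric.closedBall z₀ r ×ˢ U) ∩
      (fun p : (Vec n × ℝ) × Vec m => costRate c f J p.1 p.2) ⁻¹' Iic B)) by
    rw [hKc.closure_eq] at hmem
    obtain ⟨⟨z, u⟩, ⟨hzu, hle⟩, rfl⟩ := hmem
    exact ⟨u, hzu.2, hle⟩
  refine Metric.mem_closure_iff.2 fun δ hδ => ?_
  obtain ⟨z, ⟨hzD, hzδ⟩, θ, hθ, hmin⟩ := exists_isLocalMin_add hD hFc hz₀ (lt_min hr hδ)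
  have hzδ' := lt_min_iff.1 (Metric.mem_ball.1 hzδ)
  refine ⟨z, ?_, by rw [dist_comm]; exact hzδ'.2⟩
  have hp : fderiv ℝ J z - fderiv ℝ θ z ∈ subdifferential (univ ×ˢ Ioo 0 T) V z := by
    refine ⟨fun y => J y - θ y, (hJ.sub hθ).contDiffOn,
      (hJ.differentiable one_ne_zero z).hasFDerivAt.sub
        (hθ.differentiable one_ne_zero z).hasFDerivAt, ?_⟩
    refine IsLocalMin.on ?_ _
    filter_upwards [hmin] with y hy
    linarith
  have h1 := hV.2.1.2.2 z ⟨mem_univ _, hzD.2⟩ _ hp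
  set p := fderiv ℝ J z - fderiv ℝ θ z
  obtain ⟨u, hu, humin⟩ := hU.exists_isMinOn hUne
    (hrate.comp (f := fun u => (z, u)) (by fun_prop) fun u hu => ⟨hDI hzD, hu⟩)
  refine ⟨(z, u), ⟨⟨hzδ'.1.le, hu⟩, ?_⟩, rfl⟩
  have : Nonempty U := ⟨u, hu⟩
  have h2 : costRate c f J z u - B - p (0, 1) ≤ ⨅ u : U, hamiltonian c f z.1 z.2 p u := by
    refine le_ciInf fun ⟨w, hw⟩ => ?_
    have h3 := apply_add_hamiltonian (c := c) (f := f) z.1 z.2 p w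
    have h4 : p (f z.1 w, 1) = fderiv ℝ J z (f z.1 w, 1) - fderiv ℝ θ z (f z.1 w, 1) := rfl
    have h5 : costRate c f J z u ≤ costRate c f J z w := humin hw
    have h6 := hB z.1 hzD.1 w hw
    have h7 : costRate c f J z w = c z.1 w z.2 + fderiv ℝ J z (f z.1 w, 1) := rfl
    have h8 := hF.neg.abs_fderiv_le hzD hθ hmin (f z.1 w)
    linarith [le_abs_self (fderiv ℝ θ z (f z.1 w, 1))]
  show costRate c f J z u ≤ B
  linarith

end Residual

/-! ### Comparison of costs -/

section Comparison

open Filter Topology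

variable {n m : ℕ} {c : Vec n → Vec m → ℝ → ℝ} {g : Vec n → ℝ} {f : Vec n → Vec m → Vec n}
  {U : Set (Vec m)} {T : ℝ} {J V : Vec n × ℝ → ℝ} {x₀ : Vec n} {Ω : Set (Vec n)}
  {u v : ℝ → Vec m}

theorem IsLipschitzOCP.continuousOn_running_cost (h : IsLipschitzOCP c g f univ U T) :
    ContinuousOn (fun p : Vec n × Vec m × ℝ => c p.1 p.2.1 p.2.2) (univ ×ˢ U ×ˢ Icc 0 T) :=
  h.running_cost.continuousOn (isClosed_univ.prod (h.compact_inputs.isClosed.prod isClosed_Icc))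

theorem IsLipschitzOCP.continuousOn_vector_field (h : IsLipschitzOCP c g f univ U T) :
    ContinuousOn (fun p : Vec n × Vec m => f p.1 p.2) (univ ×ˢ U) :=
  h.vector_field.continuousOn (isClosed_univ.prod h.compact_inputs.isClosed)

/-- The verification identity: the cost of an input is `J (x₀, 0)`, plus the integrated cost rate,
plus the mismatch of the terminal data. -/
theorem cost_eq (hOCP : IsLipschitzOCP c g f univ U T) (hT : 0 ≤ T) (hJ : ContDiff ℝ 1 J)
    (hu : u ∈ admissible univ U f T x₀) :
    IntervalIntegrable (fun s => costRate c f J (solutionMap f T x₀ u s, s) (u s)) volume 0 T ∧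
      cost c g f T x₀ u = J (x₀, 0) +
        (∫ s in (0 : ℝ)..T, costRate c f J (solutionMap f T x₀ u s, s) (u s)) +
        (g (solutionMap f T x₀ u T) - J (solutionMap f T x₀ u T, T)) := by
  have hx := isSolution_solutionMap hu
  set x := solutionMap f T x₀ u
  obtain ⟨A, hA⟩ := ((isCompact_Icc.image_of_continuousOn hx.1).prod
    hOCP.compact_inputs).exists_bound_of_continuousOn
      (hOCP.continuousOn_vector_field.mono (prod_mono_left (subset_univ _)))
  obtain ⟨hi, hchain⟩ := hx.integral_fderiv hT (B := A.toNNReal) (fun t ht =>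
    (hA (x t, u t) ⟨mem_image_of_mem x ht, hu.2.1 t ht⟩).trans (Real.le_coe_toNNReal A)) hJ
  have hci := hx.intervalIntegrable_cost hOCP.continuousOn_running_cost hOCP.compact_inputs hT
    hu.1 hu.2.1
  refine ⟨hci.add hi, ?_⟩
  have : ∫ s in (0 : ℝ)..T, costRate c f J (x s, s) (u s) = _ :=
    intervalIntegral.integral_add hci hi
  rw [this, hchain, cost]
  ring

/-- If `F` is bounded by `M` on `Ω × (0, T)`, then so are its values at the terminal time. -/
theorem abs_terminal_le (hT : 0 < T) {F : Vec n × ℝ → ℝ} (hF : ContinuousOn F (univ ×ˢ Icc 0 T))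
    {M : ℝ} (hM : ∀ z ∈ Ω ×ˢ Ioo 0 T, |F z| ≤ M) {x : Vec n} (hx : x ∈ Ω) : |F (x, T)| ≤ M := by
  have h1 : ContinuousOn (fun t => F (x, t)) (Icc 0 T) :=
    hF.comp (by fun_prop) fun t ht => ⟨mem_univ _, ht⟩
  have h2 : Tendsto (fun t => |F (x, t)|) (𝓝[Ioo 0 T] T) (𝓝 |F (x, T)|) :=
    ((h1 T ⟨hT.le, le_rfl⟩).mono Ioo_subset_Icc_self).abs
  have := right_nhdsWithin_Ioo_neBot hT
  exact le_of_tendsto h2 (eventually_mem_nhdsWithin.mono fun t ht => hM _ ⟨hx, ht⟩)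

/-- The loss estimate in terms of pointwise bounds for `J - V` and of its Lipschitz constants. The
cost of every input is at least `J (x₀, 0) - T * B - M`, and that of the feedback input, which
minimizes the cost rate, is at most `J (x₀, 0) + T * B + M`. -/
theorem cost_sub_cost_le (hOCP : IsLipschitzOCP c g f univ U T) (hT : 0 < T) (hJ : ContDiff ℝ 1 J)
    (hΩ : IsOpen Ω) (hFR : forwardReachableSet f {x₀} univ U (Icc 0 T) ⊆ Ω)
    (hV : IsHJBViscositySolution c g f U T V) (hu : u ∈ admissible univ U f T x₀)
    (hmin : ∀ t ∈ Icc 0 T, IsMinOn (costRate c f J (solutionMap f T x₀ u t, t)) U (u t))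
    (hv : v ∈ admissible univ U f T x₀) {Mx : Fin n → ℝ} {Mt M B : ℝ}
    (hF : HasCoordLipBounds (Ω ×ˢ Ioo 0 T) (fun z => J z - V z) Mx Mt)
    (hM : ∀ z ∈ Ω ×ˢ Ioo 0 T, |J z - V z| ≤ M)
    (hB : ∀ x ∈ Ω, ∀ u ∈ U, Mt + ∑ i, |f x u i| * Mx i ≤ B) :
    cost c g f T x₀ u - cost c g f T x₀ v ≤ 2 * (M + T * B) := by
  have hc := hOCP.continuousOn_running_cost
  have hf := hOCP.continuousOn_vector_field
  have hU := hOCP.compact_inputs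
  have h0T : T ∈ Icc 0 T := ⟨hT.le, le_rfl⟩
  have hmem : ∀ w ∈ admissible univ U f T x₀, ∀ t ∈ Icc 0 T, solutionMap f T x₀ w t ∈ Ω :=
    fun w hw t ht => hFR (solutionMap_mem_forwardReachableSet hOCP.vector_field hU hw ht)
  have hterm : ∀ w ∈ admissible univ U f T x₀,
      |J (solutionMap f T x₀ w T, T) - g (solutionMap f T x₀ w T)| ≤ M := fun w hw => by
    rw [← hV.2.2]
    exact abs_terminal_le hT (F := fun z => J z - V z)
      (hJ.continuous.continuousOn.sub hV.1) hM (hmem w hw T h0T)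
  obtain ⟨hiv, hcv⟩ := cost_eq hOCP hT.le hJ hv
  obtain ⟨hiu, hcu⟩ := cost_eq hOCP hT.le hJ hu
  have hlow : -(T * B) ≤
      ∫ s in (0 : ℝ)..T, costRate c f J (solutionMap f T x₀ v s, s) (v s) := by
    have := intervalIntegral.integral_mono_on_of_le_Ioo hT.le
      (intervalIntegrable_const (c := -B)) hiv fun s hs =>
        neg_le_costRate hc hf hU hJ hΩ hV hF hB
          ⟨hmem v hv s (Ioo_subset_Icc_self hs), hs⟩ (hv.2.1 s (Ioo_subset_Icc_self hs))
    simpa using this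
  have hupp : ∫ s in (0 : ℝ)..T, costRate c f J (solutionMap f T x₀ u s, s) (u s) ≤ T * B := by
    have := intervalIntegral.integral_mono_on_of_le_Ioo hT.le hiu
      (intervalIntegrable_const (c := B)) fun s hs => by
        have hs' := Ioo_subset_Icc_self hs
        obtain ⟨w, hw, hwB⟩ := exists_costRate_le hc hf hU ⟨_, hu.2.1 s hs'⟩ hJ hΩ hV hF hB
          (z₀ := (solutionMap f T x₀ u s, s)) ⟨hmem u hu s hs', hs⟩
        exact (hmin s hs' hw).trans hwB
    simpa using this
  have h1 := abs_le.1 (hterm u hu)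
  have h2 := abs_le.1 (hterm v hv)
  rw [hcu, hcv]
  linarith [h1.1, h2.2]

/-- Bounds on the weak derivatives on an open set give the coordinatewise Lipschitz bounds. -/
theorem hasCoordLipBounds_of_isWeakDeriv {D : Set (Vec n × ℝ)} (hD : IsOpen D)
    {F : Vec n × ℝ → ℝ} (hF : ContinuousOn F D) {wx : Fin n → Vec n × ℝ → ℝ} {wt : Vec n × ℝ → ℝ}
    (hx : ∀ i, IsWeakDeriv D (EuclideanSpace.single i 1, 0) F (wx i))
    (ht : IsWeakDeriv D (0, 1) F wt) {Mx : Fin n → ℝ} {Mt : ℝ} (hMx : ∀ i, 0 ≤ Mx i)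
    (hMt : 0 ≤ Mt) (hwx : ∀ i, ∀ᵐ z ∂volume.restrict D, |wx i z| ≤ Mx i)
    (hwt : ∀ᵐ z ∂volume.restrict D, |wt z| ≤ Mt) : HasCoordLipBounds D F Mx Mt := by
  intro z hz
  obtain ⟨r, hr, hrD⟩ := Metric.nhds_basis_closedBall.mem_iff.1 (hD.mem_nhds hz)
  have hev : ∀ w : Vec n × ℝ, ∀ᶠ s : ℝ in 𝓝 0, z + s • w ∈ Metric.ball z r := fun w => by
    have : Tendsto (fun s : ℝ => z + s • w) (𝓝 0) (𝓝 z) := by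
      have h : Continuous fun s : ℝ => z + s • w := by fun_prop
      simpa using h.tendsto 0
    exact this.eventually (Metric.ball_mem_nhds z hr)
  have hz' := Metric.mem_ball_self (x := z) hr
  exact ⟨fun i => (hev _).mono fun s hs =>
      (hx i).abs_sub_le hD hF (hMx i) (hwx i) hrD hz' hs,
    (hev _).mono fun s hs => ht.abs_sub_le hD hF hMt hwt hrD hz' hs⟩

theorem ae_abs_le_toReal_eLpNormEssSup {D : Set (Vec n × ℝ)} {w : Vec n × ℝ → ℝ}
    (hw : eLpNormEssSup w (volume.restrict D) ≠ ⊤) :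
    ∀ᵐ z ∂volume.restrict D, |w z| ≤ (eLpNormEssSup w (volume.restrict D)).toReal := by
  filter_upwards [enorm_ae_le_eLpNormEssSup w (volume.restrict D)] with z hz
  rw [← Real.norm_eq_abs, ← toReal_enorm]
  exact ENNReal.toReal_mono hw hz

/-- The estimate of `cost_sub_cost_le` with the constant `boundConstant`, for one choice of the weak
derivatives. -/
theorem ofReal_cost_sub_cost_le (hOCP : IsLipschitzOCP c g f univ U T) (hT : 0 < T)
    (hJ : ContDiff ℝ 1 J) (hΩ : IsOpen Ω)
    (hFR : forwardReachableSet f {x₀} univ U (Icc 0 T) ⊆ Ω)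
    (hV : IsHJBViscositySolution c g f U T V) (hu : u ∈ admissible univ U f T x₀)
    (hmin : ∀ t ∈ Icc 0 T, IsMinOn (costRate c f J (solutionMap f T x₀ u t, t)) U (u t))
    (hv : v ∈ admissible univ U f T x₀) (hC : boundConstant f Ω U T ≠ ⊤)
    {wx : Fin n → Vec n × ℝ → ℝ} {wt : Vec n × ℝ → ℝ}
    (hwx : ∀ i, IsWeakDeriv (Ω ×ˢ Ioo 0 T) (EuclideanSpace.single i 1, 0)
      (fun z => J z - V z) (wx i))
    (hwt : IsWeakDeriv (Ω ×ˢ Ioo 0 T) (0, 1) (fun z => J z - V z) wt) :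
    ENNReal.ofReal (cost c g f T x₀ u - cost c g f T x₀ v) ≤ boundConstant f Ω U T *
      (eLpNormEssSup (fun z => J z - V z) (volume.restrict (Ω ×ˢ Ioo 0 T)) +
        (∑ i, eLpNormEssSup (wx i) (volume.restrict (Ω ×ˢ Ioo 0 T))) +
        eLpNormEssSup wt (volume.restrict (Ω ×ˢ Ioo 0 T))) := by
  set μ := volume.restrict (Ω ×ˢ Ioo (0 : ℝ) T)
  set M := eLpNormEssSup (fun z => J z - V z) μ
  set Mx := fun i => eLpNormEssSup (wx i) μ
  set Mt := eLpNormEssSup wt μ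
  set Φ : ℝ≥0∞ := ⨆ i : Fin n, ⨆ x ∈ Ω, ⨆ u ∈ U, ENNReal.ofReal |f x u i|
  set K : ℝ≥0∞ := max 1 (max (ENNReal.ofReal T) (ENNReal.ofReal T * Φ)) with hK
  have hCK : boundConstant f Ω U T = 2 * K := rfl
  by_cases hfin : M + (∑ i, Mx i) + Mt = ⊤
  · have hK0 : (1 : ℝ≥0∞) ≤ K := le_max_left _ _
    rw [hfin, hCK, ENNReal.mul_top (mul_ne_zero two_ne_zero (zero_lt_one.trans_le hK0).ne')]
    exact le_top
  obtain ⟨⟨hMf, hMxf⟩, hMtf⟩ : (M ≠ ⊤ ∧ ∀ i, Mx i ≠ ⊤) ∧ Mt ≠ ⊤ := by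
    simpa [ENNReal.add_eq_top, ENNReal.sum_eq_top] using hfin
  have hΦf : Φ ≠ ⊤ := by
    intro hΦ'
    refine hC ?_
    rw [hCK, hK, hΦ', ENNReal.mul_top (ENNReal.ofReal_pos.2 hT).ne']
    simp
  have hfΦ : ∀ x ∈ Ω, ∀ u ∈ U, ∀ i, |f x u i| ≤ Φ.toReal := fun x hx u hu i => by
    have : ENNReal.ofReal |f x u i| ≤ Φ :=
      le_iSup_of_le i (le_iSup₂_of_le x hx (le_iSup₂_of_le u hu le_rfl))
    exact (ENNReal.ofReal_le_iff_le_toReal hΦf).1 this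
  have hD : IsOpen (Ω ×ˢ Ioo (0 : ℝ) T) := hΩ.prod isOpen_Ioo
  have hFc : ContinuousOn (fun z => J z - V z) (Ω ×ˢ Ioo 0 T) :=
    hJ.continuous.continuousOn.sub (hV.1.mono (prod_mono (subset_univ _) Ioo_subset_Icc_self))
  have hlip := hasCoordLipBounds_of_isWeakDeriv hD hFc hwx hwt (Mx := fun i => (Mx i).toReal)
    (Mt := Mt.toReal) (fun i => ENNReal.toReal_nonneg) ENNReal.toReal_nonneg
    (fun i => ae_abs_le_toReal_eLpNormEssSup (hMxf i)) (ae_abs_le_toReal_eLpNormEssSup hMtf)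
  have hmain := cost_sub_cost_le hOCP hT hJ hΩ hFR hV hu hmin hv hlip
    (M := M.toReal) (B := Mt.toReal + Φ.toReal * ∑ i, (Mx i).toReal)
    (fun z hz => abs_le_of_ae_restrict hD hFc (ae_abs_le_toReal_eLpNormEssSup hMf) hz)
    fun x hx u hu => by
      rw [Finset.mul_sum]
      gcongr with i
      exact hfΦ x hx u hu i
  have hsum : ∑ i, (Mx i).toReal = (∑ i, Mx i).toReal :=
    (ENNReal.toReal_sum fun i _ => hMxf i).symm
  have hsumf : ∑ i, Mx i ≠ ⊤ := ENNReal.sum_ne_top.2 fun i _ => hMxf i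
  calc ENNReal.ofReal (cost c g f T x₀ u - cost c g f T x₀ v)
      ≤ ENNReal.ofReal (2 * (M.toReal + T * (Mt.toReal + Φ.toReal * ∑ i, (Mx i).toReal))) :=
        ENNReal.ofReal_le_ofReal hmain
    _ = 2 * (M + ENNReal.ofReal T * (Mt + Φ * ∑ i, Mx i)) := by
        rw [hsum, ENNReal.ofReal_mul zero_le_two, ENNReal.ofReal_add (by positivity)
          (by positivity), ENNReal.ofReal_mul hT.le, ENNReal.ofReal_add (by positivity)
          (by positivity), ENNReal.ofReal_mul (by positivity), ENNReal.ofReal_toReal hMf,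
          ENNReal.ofReal_toReal hMtf, ENNReal.ofReal_toReal hΦf, ENNReal.ofReal_toReal hsumf]
        simp
    _ = 2 * (1 * M + (ENNReal.ofReal T * Φ) * (∑ i, Mx i) + ENNReal.ofReal T * Mt) := by ring
    _ ≤ 2 * (K * M + K * (∑ i, Mx i) + K * Mt) := by
        gcongr
        · exact le_max_left _ _
        · exact (le_max_right _ _).trans (le_max_right _ _)
        · exact (le_max_left _ _).trans (le_max_right _ _)
    _ = boundConstant f Ω U T * (M + (∑ i, Mx i) + Mt) := by rw [hCK]; ring

/-- A bound for all cost differences bounds the loss. -/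
theorem loss_le_of_forall {e : ℝ≥0∞}
    (h : ∀ v ∈ admissible univ U f T x₀,
      ENNReal.ofReal (cost c g f T x₀ u - cost c g f T x₀ v) ≤ e) :
    loss c g f univ U T x₀ u ≤ (e : EReal) := by
  rcases eq_or_ne e ⊤ with rfl | he
  · simp
  lift e to ℝ≥0 using he
  rw [loss]
  refine EReal.sub_le_of_le_add ?_
  have h1 : ((cost c g f T x₀ u - (e : ℝ) : ℝ) : EReal) ≤
      ⨅ v ∈ admissible univ U f T x₀, (cost c g f T x₀ v : EReal) := by
    refine le_iInf₂ fun v hv => ?_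
    have h2 := ENNReal.ofReal_le_coe.1 (h v hv)
    exact_mod_cast (by linarith : cost c g f T x₀ u - (e : ℝ) ≤ cost c g f T x₀ v)
  calc (cost c g f T x₀ u : EReal) = ((e : ℝ) + (cost c g f T x₀ u - (e : ℝ)) : ℝ) := by
        congr 1; ring
    _ = ((e : ℝ) : EReal) + ((cost c g f T x₀ u - (e : ℝ) : ℝ) : EReal) := EReal.coe_add _ _
    _ ≤ _ := add_le_add le_rfl h1

end Comparison
end OptimalControl

open OptimalControl

theorem mainTheorem2 {n m : ℕ}
    (c : OptimalControl.Vec n → OptimalControl.Vec m → ℝ → ℝ) (g : OptimalControl.Vec n → ℝ)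
    (f : OptimalControl.Vec n → OptimalControl.Vec m → OptimalControl.Vec n)
    (U : Set (OptimalControl.Vec m)) (T : ℝ) (hT : 0 ≤ T)
    (hOCP : OptimalControl.IsLipschitzOCP c g f Set.univ U T)
    (J : OptimalControl.Vec n × ℝ → ℝ) (hJ : ContDiff ℝ 2 J)
    (x₀ : OptimalControl.Vec n) (Ω : Set (OptimalControl.Vec n)) (hΩ : IsOpen Ω)
    (hFR : OptimalControl.forwardReachableSet f {x₀} Set.univ U (Set.Icc 0 T) ⊆ Ω)
    (V : OptimalControl.Vec n × ℝ → ℝ)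
    (hV : OptimalControl.IsHJBViscositySolution c g f U T V)
    (kJ : OptimalControl.Vec n → ℝ → OptimalControl.Vec m)
    (hkJ : ∀ x, ∀ t ∈ Set.Icc 0 T, kJ x t ∈ U ∧
      IsMinOn (OptimalControl.hamiltonian c f x t (fderiv ℝ J (x, t))) U (kJ x t))
    (uJ : ℝ → OptimalControl.Vec m)
    (huJ : uJ ∈ OptimalControl.admissible Set.univ U f T x₀)
    (hfb : ∀ t ∈ Set.Icc 0 T, uJ t = kJ (OptimalControl.solutionMap f T x₀ uJ t) t) :
    OptimalControl.loss c g f Set.univ U T x₀ uJ ≤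
      ((OptimalControl.boundConstant f Ω U T *
        OptimalControl.sobolevNorm (Ω ×ˢ Set.Ioo 0 T) (fun z => J z - V z) : ENNReal) : EReal) := by
  have hJ1 : ContDiff ℝ 1 J := hJ.of_le one_le_two
  have hmin : ∀ t ∈ Icc 0 T, IsMinOn (costRate c f J (solutionMap f T x₀ uJ t, t)) U (uJ t) := by
    intro t ht w hw
    have h1 : hamiltonian c f _ t _ _ ≤ hamiltonian c f _ t _ w :=
      (hkJ (solutionMap f T x₀ uJ t) t ht).2 hw
    rw [← hfb t ht] at h1
    simp only [mem_ofPred_eq, costRate, ← apply_add_hamiltonian]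
    linarith
  refine loss_le_of_forall fun v hv => ?_
  rcases hT.eq_or_lt with rfl | hT
  · have h0 : ∀ w ∈ admissible univ U f 0 x₀, cost c g f 0 x₀ w = g x₀ := fun w hw => by
      simp [cost, (isSolution_solutionMap hw).apply_zero le_rfl]
    simp [h0 _ huJ, h0 _ hv]
  have hD : IsOpen (Ω ×ˢ Ioo (0 : ℝ) T) := hΩ.prod isOpen_Ioo
  have hFc : ContinuousOn (fun z => J z - V z) (Ω ×ˢ Ioo 0 T) :=
    hJ.continuous.continuousOn.sub (hV.1.mono (prod_mono (subset_univ _) Ioo_subset_Icc_self))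
  have hC0 : boundConstant f Ω U T ≠ 0 :=
    mul_ne_zero two_ne_zero (zero_lt_one.trans_le (le_max_left _ _)).ne'
  by_cases hC : boundConstant f Ω U T = ⊤
  · rcases eq_or_ne (sobolevNorm (Ω ×ˢ Ioo 0 T) (fun z => J z - V z)) 0 with hS | hS
    · -- The product `⊤ * 0` is zero, so the loss has to vanish; and `J = V` on `Ω × (0, T)`.
      have hsup : eLpNormEssSup (fun z => J z - V z) (volume.restrict (Ω ×ˢ Ioo 0 T)) = 0 := by
        refine le_antisymm (hS ▸ ?_) bot_le
        exact le_iInf fun wx => le_iInf fun wt => le_iInf fun _ => by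
          rw [add_assoc]; exact le_self_add
      have hzero : ∀ z ∈ Ω ×ˢ Ioo 0 T, |J z - V z| ≤ 0 := fun z hz =>
        abs_le_of_ae_restrict hD hFc (by
          simpa [hsup] using ae_abs_le_toReal_eLpNormEssSup (hsup.trans_ne ENNReal.zero_ne_top)) hz
      have hlip : HasCoordLipBounds (Ω ×ˢ Ioo 0 T) (fun z => J z - V z) (fun _ => 0) 0 := by
        have hev : ∀ z ∈ Ω ×ˢ Ioo 0 T, ∀ w : Vec n × ℝ, ∀ᶠ s : ℝ in nhds 0,
            |J (z + s • w) - V (z + s • w) - (J z - V z)| ≤ 0 * |s| := fun z hz w => by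
          have h1 : Continuous fun s : ℝ => z + s • w := by fun_prop
          filter_upwards [h1.tendsto 0 (hD.mem_nhds (by simpa using hz))] with s hs
          rw [abs_nonpos_iff.1 (hzero _ hs), abs_nonpos_iff.1 (hzero _ hz)]
          simp
        exact fun z hz => ⟨fun i => hev z hz _, hev z hz _⟩
      have := cost_sub_cost_le hOCP hT hJ1 hΩ hFR hV huJ hmin hv hlip hzero (B := 0) (by simp)
      rw [hS, mul_zero, ENNReal.ofReal_of_nonpos (by simpa using this)]
    · rw [hC, ENNReal.top_mul hS]
      exact le_top
  · rw [← ENNReal.div_le_iff' hC0 hC]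
    refine le_iInf fun wx => le_iInf fun wt => le_iInf fun hw => ?_
    rw [ENNReal.div_le_iff' hC0 hC]
    exact ofReal_cost_sub_cost_le hOCP hT hJ1 hΩ hFR hV huJ hmin hv hC hw.1 hw.2
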